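/- Let $A\in\mathbb{R}^{m\times n}$, let $\mathbb{S}^n$ be the space of real symmetric $n\times n$ matrices with the trace inner product $\langle X,Y\rangle=\operatorname{tr}(XY)$, let $\mathbb{S}^n_+$ be the cone of positive semidefinite matrices, and let $\mathcal{F}=\{X\in\mathbb{S}^n : AX=0\}$. Let $\Psi=\delta_{\mathcal{F}\cap\mathbb{S}^n_+}:\mathbb{S}^n\to\mathbb{R}\cup\{+\infty\}$ be the indicator function, equal to $0$ on $\mathcal{F}\cap\mathbb{S}^n_+$ and $+\infty$ elsewhere, and let $\partial\Psi$ be its convex subdifferential. For $X^*\in\mathcal{F}\cap\mathbb{S}^n_+$ put \[ \mathcal{M}=\{Y\in\mathbb{S}^n_+ : AY=0,\ \operatorname{rank}Y=\operatorname{rank}X^*\}. \] Then, for every $X^*\in\mathcal{F}\cap\mathbb{S}^n_+$, the function $\Psi$ is partly smooth at $X^*$ relative to $\mathcal{M}$. That is, $\Psi$ is convex, $X^*\in\mathcal{M}$, $\partial\Psi(X^*)\neq\emptyset$, and: \begin{enumerate} \item around $X^*$, $\mathcal{M}$ is a $C^2$-manifold (on an open neighbourhood of $X^*$ it is the zero set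 of a $C^2$ map into some $\mathbb{R}^k$ with surjective derivative), and $\Psi|_{\mathcal{M}}$ is $C^2$ around $X^*$ (near $X^*$ it agrees on $\mathcal{M}$ with a real-valued $C^2$ function on a neighbourhood of $X^*$ in $\mathbb{S}^n$); \item the affine span of $\partial\Psi(X^*)$ is a translate of the normal space to $\mathcal{M}$ at $X^*$, i.e. of the orthogonal complement of the tangent space; \item $\partial\Psi$ is continuous at $X^*$ relative to $\mathcal{M}$ in the Painlevé–Kuratowski sense: whenever $X_k\in\mathcal{M}$ and $X_k\to X^*$, every limit of a convergent sequence $S_k\in\partial\Psi(X_k)$ lies in $\partial\Psi(X^*)$, and every $S\in\partial\Psi(X^*)$ is the limit of a sequence $(S_k)$ with $S_k\in\partial\Psi(X_k)$ for all large $k$. \end{enumerate} -/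

import Mathlib

open Filter Topology
open scoped Matrix Matrix.Norms.Frobenius

noncomputable section

/-! ### The Euclidean space of real symmetric matrices -/

/-- The trace inner product `⟪X, Y⟫ = tr (Xᵀ Y)` on real square matrices; the norm it induces is
the Frobenius norm. -/
instance Matrix.frobeniusInnerProductSpace (n : ℕ) :
    InnerProductSpace ℝ (Matrix (Fin n) (Fin n) ℝ) where
  inner X Y := (Xᵀ * Y).trace
  norm_sq_eq_re_inner X := by
    have h : (0 : ℝ) ≤ ∑ i, ∑ j, X i j ^ 2 :=
      Finset.sum_nonneg fun i _ => Finset.sum_nonneg fun j _ => sq_nonneg _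
    rw [Matrix.frobenius_norm_def, ← Real.sqrt_eq_rpow]
    simp only [Real.rpow_two, Real.norm_eq_abs, sq_abs]
    rw [Real.sq_sqrt h, Finset.sum_comm]
    simp [Matrix.trace, Matrix.mul_apply, sq]
  conj_inner_symm X Y := by
    rw [← Matrix.trace_transpose]
    simp
  add_left X Y Z := by simp [Matrix.add_mul]
  smul_left X Y r := by simp

/-- The space `𝕊ⁿ` of real symmetric `n × n` matrices, with the trace inner product inherited from
all matrices. -/
abbrev SymMat (n : ℕ) : Type :=
  ↥({ carrier := {X | Xᵀ = X}
      add_mem' := fun {X Y} (hX : Xᵀ = X) (hY : Yᵀ = Y) => by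
        change (X + Y)ᵀ = X + Y
        rw [Matrix.transpose_add, hX, hY]
      zero_mem' := Matrix.transpose_zero
      smul_mem' := fun c X (hX : Xᵀ = X) => by
        change (c • X)ᵀ = c • X
        rw [Matrix.transpose_smul, hX] } : Submodule ℝ (Matrix (Fin n) (Fin n) ℝ))

/-- The cone `𝕊ⁿ₊` of positive semidefinite matrices. -/
def psdCone (n : ℕ) : Set (SymMat n) :=
  {X | (X : Matrix (Fin n) (Fin n) ℝ).PosSemidef}

/-- The subspace `ℱ = {X ∈ 𝕊ⁿ | A X = 0}`. -/
def facialSubspace {m n : ℕ} (A : Matrix (Fin m) (Fin n) ℝ) : Set (SymMat n) :=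
  {X | A * (X : Matrix (Fin n) (Fin n) ℝ) = 0}

/-- The set `{Y ∈ 𝕊ⁿ₊ | A Y = 0, rank Y = rank X}`. -/
def fixedRankFace {m n : ℕ} (A : Matrix (Fin m) (Fin n) ℝ) (X : SymMat n) : Set (SymMat n) :=
  {Y | Y ∈ psdCone n ∧ A * (Y : Matrix (Fin n) (Fin n) ℝ) = 0 ∧
    (Y : Matrix (Fin n) (Fin n) ℝ).rank = (X : Matrix (Fin n) (Fin n) ℝ).rank}

/-! ### Convex analysis in a Euclidean space -/

open Classical in
/-- The indicator function `δ_C` of convex analysis: `0` on `C` and `+∞` off `C`. -/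
def convexIndicator {E : Type*} (C : Set E) (x : E) : EReal :=
  if x ∈ C then 0 else ⊤

section

variable {E : Type*} [NormedAddCommGroup E] [InnerProductSpace ℝ E]

/-- Convexity of an extended-real-valued function: its epigraph is convex. -/
def IsConvexFun (f : E → EReal) : Prop :=
  Convex ℝ {p : E × ℝ | f p.1 ≤ (p.2 : EReal)}

/-- The subdifferential `∂f(x)` of convex analysis; it is empty where `f` is not finite. -/
def subdifferential (f : E → EReal) (x : E) : Set E :=
  {s | f x ≠ ⊥ ∧ f x ≠ ⊤ ∧ ∀ y, f x + ((inner ℝ s (y - x) : ℝ) : EReal) ≤ f y}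

/-- Around `x`, the set `M` is a `C²`-manifold: near `x` it is the zero set of finitely many `C²`
equations whose derivatives are linearly independent. -/
def IsC2ManifoldAround (M : Set E) (x : E) : Prop :=
  ∃ (k : ℕ) (V : Set E) (G : E → EuclideanSpace ℝ (Fin k)),
    IsOpen V ∧ x ∈ V ∧ ContDiffOn ℝ 2 G V ∧
      (∀ y ∈ V, Function.Surjective (fderiv ℝ G y)) ∧
      M ∩ V = {y | y ∈ V ∧ G y = 0}

/-- `f` restricted to `M` is `C²` around `x`: near `x` it agrees on `M` with a real-valued function
that is `C²` near `x` in the ambient space. -/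
def IsC2AlongAround (f : E → EReal) (M : Set E) (x : E) : Prop :=
  ∃ g : E → ℝ, ContDiffAt ℝ 2 g x ∧ ∀ᶠ y in 𝓝[M] x, f y = (g y : EReal)

/-- The velocities at `x` of the `C²` curves in `M` through `x`; when `M` is a `C²`-manifold around
`x ∈ M`, this is the tangent space to `M` at `x`. -/
def tangentVectors (M : Set E) (x : E) : Set E :=
  {v | ∃ γ : ℝ → E, γ 0 = x ∧ (∀ᶠ t in 𝓝 (0 : ℝ), γ t ∈ M) ∧
    ContDiffAt ℝ 2 γ 0 ∧ HasDerivAt γ v 0}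

/-- The normal space to `M` at `x`: the orthogonal complement of the tangent space. -/
def normalSpace (M : Set E) (x : E) : Submodule ℝ E :=
  (Submodule.span ℝ (tangentVectors M x))ᗮ

/-- Outer semicontinuity (Painlevé–Kuratowski) of a set-valued map at `x` relative to `M`. -/
def OuterSemicontinuousRel (T : E → Set E) (M : Set E) (x : E) : Prop :=
  ∀ (u s : ℕ → E) (y : E), (∀ k, u k ∈ M) → Tendsto u atTop (𝓝 x) →
    (∀ k, s k ∈ T (u k)) → Tendsto s atTop (𝓝 y) → y ∈ T x

/-- Inner semicontinuity (Painlevé–Kuratowski) of a set-valued map at `x` relative to `M`. -/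
def InnerSemicontinuousRel (T : E → Set E) (M : Set E) (x : E) : Prop :=
  ∀ (u : ℕ → E) (y : E), (∀ k, u k ∈ M) → Tendsto u atTop (𝓝 x) → y ∈ T x →
    ∃ s : ℕ → E, (∀ᶠ k in atTop, s k ∈ T (u k)) ∧ Tendsto s atTop (𝓝 y)

/-- The convex function `f` is partly smooth at `x` relative to the set `M ∋ x`. -/
structure IsPartlySmooth (f : E → EReal) (M : Set E) (x : E) : Prop where
  convex : IsConvexFun f
  mem : x ∈ M
  subdifferential_nonempty : (subdifferential f x).Nonempty
  manifold : IsC2ManifoldAround M x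
  smooth : IsC2AlongAround f M x
  sharp : ∃ a : E, affineSpan ℝ (subdifferential f x) = AffineSubspace.mk' a (normalSpace M x)
  outer : OuterSemicontinuousRel (subdifferential f) M x
  inner : InnerSemicontinuousRel (subdifferential f) M x

end

end

/-! Let `C` be the face `ℱ ∩ 𝕊ⁿ₊`, let `P` and `Q` be the orthogonal projections onto `ker A` and
onto the range of `X`, and note that `PQ = QP = Q` because `AX = 0`. Everything reduces to block
algebra for these projections.

Sharpness: the normal space and the affine span of the subdifferential both equal `{S | P S X = 0}`.
Subgradients are normal because they are maximized over `C` at `X`; normal matrices satisfy the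
equation (`mul_mul_eq_zero_of_mem_normalSpace`); its solutions are differences of subgradients
(`exists_sub_eq_of_mul_mul_eq_zero`).

Manifold: near `X` the block of `Y` on the range of `Q` is positive definite, so having the rank of
`X` means that the Schur complement vanishes (`mem_fixedRankFace_iff`). Subtracting the Schur
correction is an invertible `C²` change of variable that turns the face into the kernel of a linear
map.

Continuity: outer semicontinuity is a passage to the limit. For inner semicontinuity, a congruence
close to the identity that preserves `C` moves a subgradient at `X` to one at a nearby point of the
manifold. -/

/-! ### Matrix preliminaries -/

/-- A real symmetric matrix has a symmetric inner inverse that commutes with it. -/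
theorem Matrix.exists_symm_pseudoinverse {n : ℕ} {X : Matrix (Fin n) (Fin n) ℝ} (hX : Xᵀ = X) :
    ∃ Z : Matrix (Fin n) (Fin n) ℝ, Zᵀ = Z ∧ Z * X = X * Z ∧ X * Z * X = X ∧ Z * X * Z = Z := by
  have hH : X.IsHermitian := hX
  set U := hH.eigenvectorUnitary
  set d := hH.eigenvalues
  have hspec : X = U * Matrix.diagonal d * star (U : Matrix (Fin n) (Fin n) ℝ) := by
    have h := hH.spectral_theorem
    rw [Unitary.conjStarAlgAut_apply] at h
    exact h
  have hU : star (U : Matrix (Fin n) (Fin n) ℝ) * U = 1 := Unitary.coe_star_mul_self U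
  have hconj (a b : Fin n → ℝ) :
      U * Matrix.diagonal a * star (U : Matrix (Fin n) (Fin n) ℝ) *
        (U * Matrix.diagonal b * star (U : Matrix (Fin n) (Fin n) ℝ)) =
      U * Matrix.diagonal (fun i => a i * b i) * star (U : Matrix (Fin n) (Fin n) ℝ) := by
    rw [← Matrix.diagonal_mul_diagonal]
    simp only [Matrix.mul_assoc]
    rw [← Matrix.mul_assoc (star _) (U : Matrix (Fin n) (Fin n) ℝ), hU, Matrix.one_mul]
  -- The convention `0⁻¹ = 0` makes this the pseudo-inverse even when some eigenvalues vanish.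
  refine ⟨U * Matrix.diagonal (fun i => (d i)⁻¹) * star (U : Matrix (Fin n) (Fin n) ℝ),
    ?_, ?_, ?_, ?_⟩
  · simp [Matrix.star_eq_conjTranspose, Matrix.mul_assoc]
  · rw [hspec, hconj, hconj]
    simp only [mul_comm]
  · rw [hspec, hconj, hconj]
    congr 4
    ext i
    exact mul_inv_mul_cancel (d i)
  · rw [hspec, hconj, hconj]
    congr 4
    ext i
    simpa using mul_inv_mul_cancel (d i)⁻¹

/-- There is an orthogonal projection onto the kernel of a real matrix. -/
theorem Matrix.exists_kernel_projection {m n : ℕ} (A : Matrix (Fin m) (Fin n) ℝ) :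
    ∃ P : Matrix (Fin n) (Fin n) ℝ, Pᵀ = P ∧ A * P = 0 ∧
      ∀ Y : Matrix (Fin n) (Fin n) ℝ, A * Y = 0 → P * Y = Y := by
  have hW : (Aᵀ * A)ᵀ = Aᵀ * A := by simp
  obtain ⟨Z, hZ, hc, h1, -⟩ := Matrix.exists_symm_pseudoinverse hW
  -- `Z (Aᵀ A)` projects onto the range of `Aᵀ A`, whose orthogonal complement is `ker (Aᵀ A) = ker
  -- A`.
  refine ⟨1 - Z * (Aᵀ * A), ?_, ?_, fun Y hY => ?_⟩
  · rw [Matrix.transpose_sub, Matrix.transpose_mul, hW, hZ, hc, Matrix.transpose_one]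
  · have h := (Matrix.conjTranspose_mul_self_mul_eq_zero A (1 - Z * (Aᵀ * A))).1
    rw [Matrix.conjTranspose_eq_transpose_of_trivial] at h
    apply h
    rw [Matrix.mul_sub, Matrix.mul_one, ← Matrix.mul_assoc (Aᵀ * A), h1, sub_self]
  · rw [Matrix.sub_mul, Matrix.one_mul, Matrix.mul_assoc, Matrix.mul_assoc, hY]
    simp

/-- If `Y * B` has the rank of `Y`, then `Y` factors through `Y * B`. -/
theorem Matrix.exists_eq_mul_of_rank_le {n : ℕ} {Y B : Matrix (Fin n) (Fin n) ℝ}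
    (h : Y.rank ≤ (Y * B).rank) : ∃ W, Y = Y * B * W := by
  have hle : (Y * B).mulVecLin.range ≤ Y.mulVecLin.range := by
    rw [Matrix.mulVecLin_mul]
    exact LinearMap.range_comp_le_range _ _
  have heq := Submodule.eq_of_le_of_finrank_le hle h
  have hex (j : Fin n) : ∃ w, (Y * B) *ᵥ w = Y.col j := by
    have hj : Y.col j ∈ Y.mulVecLin.range := ⟨Pi.single j 1, by simp⟩
    rw [← heq] at hj
    exact hj
  choose w hw using hex
  refine ⟨Matrix.of fun i j => w j i, ?_⟩
  ext i j
  exact (congrFun (hw j) i).symm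

/-- By homogeneity the unit sphere suffices, and its compactness gives stability. Symmetry is left
out of the condition, since it would not be open among all matrices. -/
theorem Matrix.isOpen_setOf_forall_dotProduct_mulVec_pos (n : ℕ) :
    IsOpen {M : Matrix (Fin n) (Fin n) ℝ | ∀ x, x ≠ 0 → 0 < x ⬝ᵥ (M *ᵥ x)} := by
  have hset : {M : Matrix (Fin n) (Fin n) ℝ | ∀ x, x ≠ 0 → 0 < x ⬝ᵥ (M *ᵥ x)} =
      {M | ∀ x ∈ Metric.sphere (0 : Fin n → ℝ) 1, 0 < x ⬝ᵥ (M *ᵥ x)} := by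
    ext M
    refine ⟨fun h x hx => h x (ne_zero_of_mem_unit_sphere ⟨x, hx⟩), fun h x hx => ?_⟩
    have hn : 0 < ‖x‖ := norm_pos_iff.2 hx
    have h1 := h (‖x‖⁻¹ • x) (by simp [norm_smul, hn.ne'])
    rw [Matrix.mulVec_smul, smul_dotProduct, dotProduct_smul, smul_eq_mul, smul_eq_mul] at h1
    exact pos_of_mul_pos_right (pos_of_mul_pos_right h1 (by positivity)) (by positivity)
  rw [hset, isOpen_iff_eventually]
  intro M hM
  refine (isCompact_sphere (0 : Fin n → ℝ) 1).eventually_forall_of_forall_eventually fun x hx => ?_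
  have hc : Continuous fun z : Matrix (Fin n) (Fin n) ℝ × (Fin n → ℝ) => z.2 ⬝ᵥ (z.1 *ᵥ z.2) :=
    continuous_snd.dotProduct (continuous_fst.matrix_mulVec continuous_snd)
  exact hc.continuousAt.eventually_const_lt (hM x hx)

theorem Matrix.contDiffAt_inv {n : ℕ} {M : Matrix (Fin n) (Fin n) ℝ} (hM : IsUnit M) :
    ContDiffAt ℝ 2 (fun N : Matrix (Fin n) (Fin n) ℝ => N⁻¹) M := by
  obtain ⟨u, rfl⟩ := hM
  have : CompleteSpace (Matrix (Fin n) (Fin n) ℝ) := FiniteDimensional.complete ℝ _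
  have h := contDiffAt_ringInverse ℝ (n := 2) u
  exact h.congr_of_eventuallyEq (.of_forall fun N => Matrix.nonsing_inv_eq_ringInverse N)

/-! ### Indicator functions of convex sets -/

theorem convexIndicator_of_mem {E : Type*} {C : Set E} {x : E} (hx : x ∈ C) :
    convexIndicator C x = 0 := if_pos hx

theorem convexIndicator_of_notMem {E : Type*} {C : Set E} {x : E} (hx : x ∉ C) :
    convexIndicator C x = ⊤ := if_neg hx

section Indicator

variable {E : Type*} [NormedAddCommGroup E] [InnerProductSpace ℝ E] {C M : Set E} {x : E}

theorem isConvexFun_convexIndicator (hC : Convex ℝ C) : IsConvexFun (convexIndicator C) := by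
  have h : {p : E × ℝ | convexIndicator C p.1 ≤ (p.2 : EReal)} = C ×ˢ Set.Ici (0 : ℝ) := by
    ext ⟨y, r⟩
    by_cases hy : y ∈ C
    · simp [convexIndicator_of_mem hy, hy]
    · simp [convexIndicator_of_notMem hy, hy]
  rw [IsConvexFun, h]
  exact hC.prod (convex_Ici 0)

theorem mem_subdifferential_convexIndicator_iff (hx : x ∈ C) {s : E} :
    s ∈ subdifferential (convexIndicator C) x ↔ ∀ y ∈ C, inner ℝ s (y - x) ≤ 0 := by
  simp only [subdifferential, Set.mem_ofPred_eq, convexIndicator_of_mem hx, zero_add]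
  refine ⟨fun h y hy => ?_, fun h => ⟨EReal.zero_ne_bot, EReal.zero_ne_top, fun y => ?_⟩⟩
  · have := h.2.2 y
    rw [convexIndicator_of_mem hy] at this
    exact_mod_cast this
  · by_cases hy : y ∈ C
    · rw [convexIndicator_of_mem hy]
      exact_mod_cast h y hy
    · rw [convexIndicator_of_notMem hy]
      exact le_top

theorem zero_mem_subdifferential_convexIndicator (hx : x ∈ C) :
    (0 : E) ∈ subdifferential (convexIndicator C) x := by
  rw [mem_subdifferential_convexIndicator_iff hx]
  intro y _
  simp

theorem outerSemicontinuousRel_subdifferential_convexIndicator (hM : M ⊆ C) (hx : x ∈ C) :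
    OuterSemicontinuousRel (subdifferential (convexIndicator C)) M x := by
  intro u s y hu hux hs hsy
  rw [mem_subdifferential_convexIndicator_iff hx]
  intro z hz
  refine le_of_tendsto (hsy.inner (tendsto_const_nhds.sub hux)) (.of_forall fun k => ?_)
  exact (mem_subdifferential_convexIndicator_iff (hM (hu k))).1 (hs k) z hz

/-- Subgradients of the indicator function of `C` are normal to every subset of `C`. -/
theorem subdifferential_convexIndicator_subset_normalSpace (hM : M ⊆ C) (hx : x ∈ C) :
    subdifferential (convexIndicator C) x ⊆ normalSpace M x := by
  intro s hs
  rw [mem_subdifferential_convexIndicator_iff hx] at hs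
  rw [SetLike.mem_coe, normalSpace, Submodule.mem_orthogonal']
  intro v hv
  induction hv using Submodule.span_induction with
  | zero => exact inner_zero_right s
  | add v w _ _ hv hw => rw [inner_add_right, hv, hw, add_zero]
  | smul c v _ hv => rw [inner_smul_right, hv, mul_zero]
  | mem v hv =>
    obtain ⟨γ, h0, hγ, -, hd⟩ := hv
    -- The functional `⟪s, ·⟫` is maximal over `C` at `x`, hence along every curve in `M` through
    -- `x`.
    have hmax : IsLocalMax (fun t => inner ℝ s (γ t)) 0 := by
      filter_upwards [hγ] with t ht
      have h := hs _ (hM ht)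
      rw [inner_sub_right] at h
      rw [h0]
      linarith
    have hd' : HasDerivAt (fun t => inner ℝ s (γ t)) (inner ℝ s v) 0 := by
      simpa using (hasDerivAt_const (0 : ℝ) s).inner ℝ hd
    exact hmax.hasDerivAt_eq_zero hd'

end Indicator

/-! ### The face of the semidefinite cone cut out by `A X = 0` -/

theorem SymMat.transpose_coe {n : ℕ} (X : SymMat n) :
    (X : Matrix (Fin n) (Fin n) ℝ)ᵀ = X := X.2

theorem SymMat.inner_eq_trace {n : ℕ} (X Y : SymMat n) :
    inner ℝ X Y = ((X : Matrix (Fin n) (Fin n) ℝ) * Y).trace := by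
  change ((X : Matrix (Fin n) (Fin n) ℝ)ᵀ * Y).trace = _
  rw [X.transpose_coe]

theorem convex_facialSubspace_inter_psdCone {m n : ℕ} (A : Matrix (Fin m) (Fin n) ℝ) :
    Convex ℝ (facialSubspace A ∩ psdCone n) := by
  rintro X ⟨hX, hX'⟩ Y ⟨hY, hY'⟩ a b ha hb -
  refine ⟨?_, Matrix.PosSemidef.add (hX'.smul ha) (hY'.smul hb)⟩
  change A * (a • (X : Matrix (Fin n) (Fin n) ℝ) + b • (Y : Matrix (Fin n) (Fin n) ℝ)) = 0
  rw [Matrix.mul_add, Matrix.mul_smul, Matrix.mul_smul, show A * X.1 = 0 from hX,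
    show A * Y.1 = 0 from hY]
  simp

theorem fixedRankFace_subset {m n : ℕ} (A : Matrix (Fin m) (Fin n) ℝ) (X : SymMat n) :
    fixedRankFace A X ⊆ facialSubspace A ∩ psdCone n := fun _ hY => ⟨hY.2.1, hY.1⟩

/-- `P` is the orthogonal projection onto `ker A`, `Z` is the pseudo-inverse of `X` and `Q` is the
orthogonal projection onto the range of `X`, a subspace of `ker A`. -/
structure IsFaceProjection {m n : ℕ} (A : Matrix (Fin m) (Fin n) ℝ)
    (X P Q Z : Matrix (Fin n) (Fin n) ℝ) : Prop where
  P_symm : Pᵀ = P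
  Q_symm : Qᵀ = Q
  A_mul_P : A * P = 0
  P_mul : ∀ Y : Matrix (Fin n) (Fin n) ℝ, A * Y = 0 → P * Y = Y
  X_mul_Z : X * Z = Q
  Z_mul_X : Z * X = Q
  Q_mul_X : Q * X = X
  X_mul_Q : X * Q = X
  Q_mul_Z : Q * Z = Z
  Q_mul_Q : Q * Q = Q
  A_mul_Q : A * Q = 0

theorem exists_isFaceProjection {m n : ℕ} {A : Matrix (Fin m) (Fin n) ℝ}
    {X : Matrix (Fin n) (Fin n) ℝ} (hX : Xᵀ = X) (hA : A * X = 0) :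
    ∃ P Q Z, IsFaceProjection A X P Q Z := by
  obtain ⟨P, hP, hAP, hPY⟩ := A.exists_kernel_projection
  obtain ⟨Z, hZ, hc, h1, h2⟩ := Matrix.exists_symm_pseudoinverse hX
  refine ⟨P, X * Z, Z, hP, ?_, hAP, hPY, rfl, hc, h1, ?_, ?_, ?_, ?_⟩
  · rw [Matrix.transpose_mul, hZ, hX, hc]
  · rw [← hc, ← Matrix.mul_assoc, h1]
  · rw [← hc, h2]
  · rw [← Matrix.mul_assoc, h1]
  · rw [← Matrix.mul_assoc, hA, Matrix.zero_mul]

namespace IsFaceProjection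

variable {m n : ℕ} {A : Matrix (Fin m) (Fin n) ℝ} {X : SymMat n}
  {P Q Z : Matrix (Fin n) (Fin n) ℝ}

theorem P_mul_P {X : Matrix (Fin n) (Fin n) ℝ} (h : IsFaceProjection A X P Q Z) : P * P = P :=
  h.P_mul P h.A_mul_P

theorem P_mul_Q {X : Matrix (Fin n) (Fin n) ℝ} (h : IsFaceProjection A X P Q Z) : P * Q = Q :=
  h.P_mul Q h.A_mul_Q

theorem Q_mul_P {X : Matrix (Fin n) (Fin n) ℝ} (h : IsFaceProjection A X P Q Z) : Q * P = Q := by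
  have := congrArg Matrix.transpose h.P_mul_Q
  rwa [Matrix.transpose_mul, h.P_symm, h.Q_symm] at this

theorem mul_P {X : Matrix (Fin n) (Fin n) ℝ} (h : IsFaceProjection A X P Q Z)
    {Y : Matrix (Fin n) (Fin n) ℝ} (hY : Yᵀ = Y) (hA : A * Y = 0) : Y * P = Y := by
  have := congrArg Matrix.transpose (h.P_mul Y hA)
  rwa [Matrix.transpose_mul, h.P_symm, hY] at this

/-- The curves `(1 + tE) X (1 + tE)ᵀ` with `A E = 0` stay in the fixed-rank face. -/
theorem mem_tangentVectors (h : IsFaceProjection A X P Q Z) (hX : X ∈ psdCone n)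
    {E : Matrix (Fin n) (Fin n) ℝ} (hE : A * E = 0) {v : SymMat n}
    (hv : (v : Matrix (Fin n) (Fin n) ℝ) = E * X + X * Eᵀ) :
    v ∈ tangentVectors (fixedRankFace A X) X := by
  have hAX : A * (X : Matrix (Fin n) (Fin n) ℝ) = 0 := by
    rw [← h.Q_mul_X, ← Matrix.mul_assoc, h.A_mul_Q, Matrix.zero_mul]
  let w : SymMat n := ⟨E * X * Eᵀ, by
    change (E * X.1 * Eᵀ)ᵀ = _
    simp [Matrix.mul_assoc, X.transpose_coe]⟩
  let γ : ℝ → SymMat n := fun t => X + t • v + (t ^ 2) • w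
  have hγ (t : ℝ) : (γ t : Matrix (Fin n) (Fin n) ℝ) = (1 + t • E) * X.1 * (1 + t • E)ᵀ := by
    change (X : Matrix (Fin n) (Fin n) ℝ) + t • (v : Matrix (Fin n) (Fin n) ℝ)
      + (t ^ 2) • (E * X * Eᵀ) = _
    rw [hv]
    simp only [Matrix.transpose_add, Matrix.transpose_one, Matrix.transpose_smul, Matrix.add_mul,
      Matrix.mul_add, Matrix.one_mul, Matrix.mul_one, Matrix.smul_mul, Matrix.mul_smul, smul_add,
      smul_smul, sq]
    abel
  refine ⟨γ, by simp [γ], ?_, ?_, ?_⟩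
  · have hdet : ∀ᶠ t in 𝓝 (0 : ℝ), (1 + t • E).det ≠ 0 := by
      have hc : Continuous fun t : ℝ => (1 + t • E).det := by fun_prop
      exact hc.continuousAt.eventually_ne (by simp)
    filter_upwards [hdet] with t ht
    have hu : IsUnit (1 + t • E).det := ht.isUnit
    refine ⟨?_, ?_, ?_⟩
    · change (γ t : Matrix (Fin n) (Fin n) ℝ).PosSemidef
      rw [hγ, ← Matrix.conjTranspose_eq_transpose_of_trivial]
      exact Matrix.PosSemidef.mul_mul_conjTranspose_same hX _
    · rw [hγ, ← Matrix.mul_assoc, ← Matrix.mul_assoc, Matrix.mul_add, Matrix.mul_smul, hE]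
      simp [hAX]
    · rw [hγ, Matrix.rank_mul_eq_left_of_isUnit_det, Matrix.rank_mul_eq_right_of_isUnit_det _ _ hu]
      rwa [Matrix.det_transpose]
  · exact ContDiff.contDiffAt (by fun_prop)
  · have h1 := ((hasDerivAt_id (0 : ℝ)).smul_const v).const_add X
    have h2 := ((hasDerivAt_id (0 : ℝ)).pow 2).smul_const w
    have h3 := h1.add h2
    simp only [id, one_smul, Nat.cast_ofNat, mul_zero, zero_smul, add_zero, mul_one,
      Nat.add_one_sub_one, pow_one] at h3
    exact h3

/-- With `E = P S X`, the tangent vector `E X + X Eᵀ` pairs with `S` to `2 tr (Eᵀ E)`, so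
orthogonality forces `E = 0`. -/
theorem mul_mul_eq_zero_of_mem_normalSpace (h : IsFaceProjection A X P Q Z) (hX : X ∈ psdCone n)
    {S : SymMat n} (hS : S ∈ normalSpace (fixedRankFace A X) X) :
    P * (S : Matrix (Fin n) (Fin n) ℝ) * X = 0 := by
  set E : Matrix (Fin n) (Fin n) ℝ := P * (S : Matrix (Fin n) (Fin n) ℝ) * X with hEdef
  have hEt : Eᵀ = (X : Matrix (Fin n) (Fin n) ℝ) * S * P := by
    simp [hEdef, Matrix.mul_assoc, X.transpose_coe, S.transpose_coe, h.P_symm]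
  let v : SymMat n := ⟨E * X + X * Eᵀ, by
    change (E * X.1 + X.1 * Eᵀ)ᵀ = _
    simp [X.transpose_coe, add_comm]⟩
  have hAE : A * E = 0 := by
    rw [hEdef, ← Matrix.mul_assoc, ← Matrix.mul_assoc, h.A_mul_P]
    simp
  have hv := h.mem_tangentVectors hX hAE (v := v) rfl
  have h0 := (Submodule.mem_orthogonal' _ _).1 hS v (Submodule.subset_span hv)
  rw [SymMat.inner_eq_trace] at h0
  change ((S : Matrix (Fin n) (Fin n) ℝ) * (E * X + X * Eᵀ)).trace = 0 at h0
  have e1 : ((S : Matrix (Fin n) (Fin n) ℝ) * (E * X)).trace = (Eᵀ * E).trace := by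
    conv_rhs => rw [hEt, Matrix.mul_assoc, h.P_mul E hAE]
    rw [← Matrix.mul_assoc, Matrix.trace_mul_comm, ← Matrix.mul_assoc]
  have e2 : ((S : Matrix (Fin n) (Fin n) ℝ) * (X * Eᵀ)).trace = (Eᵀ * E).trace := by
    rw [← e1, ← Matrix.trace_transpose]
    simp only [Matrix.transpose_mul, Matrix.transpose_transpose, X.transpose_coe, S.transpose_coe]
    rw [Matrix.trace_mul_comm]
  rw [Matrix.mul_add, Matrix.trace_add, e1, e2] at h0
  apply (Matrix.trace_conjTranspose_mul_self_eq_zero_iff).1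
  rw [Matrix.conjTranspose_eq_transpose_of_trivial]
  linarith

/-- A symmetric matrix whose compression to `ker A` is negative semidefinite and vanishes on the
range of `X` is a subgradient. -/
theorem mem_subdifferential (h : IsFaceProjection A X P Q Z)
    (hX : X ∈ facialSubspace A ∩ psdCone n) {S : SymMat n} {F : Matrix (Fin n) (Fin n) ℝ}
    (hSX : P * (S : Matrix (Fin n) (Fin n) ℝ) * X = 0)
    (hF : P * (S : Matrix (Fin n) (Fin n) ℝ) * P = -(Fᵀ * F)) :
    S ∈ subdifferential (convexIndicator (facialSubspace A ∩ psdCone n)) X := by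
  rw [mem_subdifferential_convexIndicator_iff hX]
  intro Y hY
  have hYP : (Y : Matrix (Fin n) (Fin n) ℝ) * P = Y := h.mul_P Y.transpose_coe hY.1
  have hXP : (X : Matrix (Fin n) (Fin n) ℝ) * P = X := h.mul_P X.transpose_coe hX.1
  have e1 : ((S : Matrix (Fin n) (Fin n) ℝ) * X).trace = 0 := by
    conv_lhs => rw [← hXP]
    rw [← Matrix.mul_assoc, Matrix.trace_mul_comm, ← Matrix.mul_assoc, hSX, Matrix.trace_zero]
  -- Since `Y = P Y P`, the pairing only sees the compression `P S P = -Fᵀ F`.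
  have e2 : ((S : Matrix (Fin n) (Fin n) ℝ) * Y).trace = -(F * Y * Fᵀ).trace := by
    have hPY : P * (Y : Matrix (Fin n) (Fin n) ℝ) = Y := h.P_mul Y hY.1
    conv_lhs => rw [← hYP]
    rw [← Matrix.mul_assoc, Matrix.trace_mul_comm, ← Matrix.mul_assoc]
    conv_lhs => rw [← hPY]
    rw [← Matrix.mul_assoc, hF, Matrix.neg_mul, Matrix.trace_neg, Matrix.mul_assoc,
      Matrix.trace_mul_comm]
  have hpos : 0 ≤ (F * (Y : Matrix (Fin n) (Fin n) ℝ) * Fᴴ).trace :=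
    (Matrix.PosSemidef.mul_mul_conjTranspose_same hY.2 F).trace_nonneg
  rw [Matrix.conjTranspose_eq_transpose_of_trivial] at hpos
  rw [inner_sub_right, SymMat.inner_eq_trace, SymMat.inner_eq_trace, e1, e2]
  linarith

/-- `N = P - Q` acts as the identity on both sides of `D = P S P`, so `D = T₁² - T₂²` with `T₁ = (D
+ N)/2` and `T₂ = (D - N)/2`. Both factors annihilate `X`, hence `S₂ = -T₁²` and `S₁ = S - T₁²`,
whose compression is `-T₂²`, are subgradients. -/
theorem exists_sub_eq_of_mul_mul_eq_zero (h : IsFaceProjection A X P Q Z)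
    (hX : X ∈ facialSubspace A ∩ psdCone n) {S : SymMat n}
    (hSX : P * (S : Matrix (Fin n) (Fin n) ℝ) * X = 0) :
    ∃ S₁ ∈ subdifferential (convexIndicator (facialSubspace A ∩ psdCone n)) X,
      ∃ S₂ ∈ subdifferential (convexIndicator (facialSubspace A ∩ psdCone n)) X, S = S₁ - S₂ := by
  set D : Matrix (Fin n) (Fin n) ℝ := P * S * P with hD
  set N : Matrix (Fin n) (Fin n) ℝ := P - Q with hN
  have hDt : Dᵀ = D := by
    simp [hD, Matrix.mul_assoc, h.P_symm, S.transpose_coe]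
  have hNt : Nᵀ = N := by rw [hN, Matrix.transpose_sub, h.P_symm, h.Q_symm]
  have hPX : P * (X : Matrix (Fin n) (Fin n) ℝ) = X := h.P_mul X hX.1
  have hDX : D * X = 0 := by rw [hD, Matrix.mul_assoc, hPX, hSX]
  have hNX : N * X = 0 := by rw [hN, Matrix.sub_mul, hPX, h.Q_mul_X, sub_self]
  have hPD : P * D = D := by rw [hD, ← Matrix.mul_assoc, ← Matrix.mul_assoc, h.P_mul_P]
  have hDP : D * P = D := by rw [hD, Matrix.mul_assoc, h.P_mul_P]
  have hPN : P * N = N := by rw [hN, Matrix.mul_sub, h.P_mul_P, h.P_mul_Q]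
  have hNP : N * P = N := by rw [hN, Matrix.sub_mul, h.P_mul_P, h.Q_mul_P]
  have hDN : D * N = D := by
    rw [hN, Matrix.mul_sub, hDP, ← h.X_mul_Z, ← Matrix.mul_assoc, hDX, Matrix.zero_mul, sub_zero]
  have hND : N * D = D := by
    have := congrArg Matrix.transpose hDN
    rwa [Matrix.transpose_mul, hDt, hNt] at this
  have key (c : ℝ) : ∀ T : Matrix (Fin n) (Fin n) ℝ,
      T = (1 / 2 : ℝ) • (D + c • N) → Tᵀ = T ∧ P * T = T ∧ T * P = T ∧ T * X = 0 := by
    rintro T rfl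
    simp [Matrix.mul_add, Matrix.add_mul, hDt, hNt, hPD, hDP, hPN, hNP, hDX, hNX]
  obtain ⟨ht, hP1, hP2, hX0⟩ := key 1 _ rfl
  obtain ⟨ht', hP1', hP2', hX0'⟩ := key (-1) _ rfl
  have hdiff : D = ((1 / 2 : ℝ) • (D + (1 : ℝ) • N)) * ((1 / 2 : ℝ) • (D + (1 : ℝ) • N)) -
      ((1 / 2 : ℝ) • (D + (-1 : ℝ) • N)) * ((1 / 2 : ℝ) • (D + (-1 : ℝ) • N)) := by
    simp only [Matrix.mul_add, Matrix.add_mul, Matrix.smul_mul, Matrix.mul_smul, smul_add,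
      smul_smul, hDN, hND]
    module
  set T₁ := (1 / 2 : ℝ) • (D + (1 : ℝ) • N)
  set T₂ := (1 / 2 : ℝ) • (D + (-1 : ℝ) • N)
  let S₂ : SymMat n := ⟨-(T₁ᵀ * T₁), by
    change (-(T₁ᵀ * T₁))ᵀ = _
    simp⟩
  have hS₂ : (S₂ : Matrix (Fin n) (Fin n) ℝ) = -(T₁ᵀ * T₁) := rfl
  have hS₁ : ((S + S₂ : SymMat n) : Matrix (Fin n) (Fin n) ℝ) = S - T₁ᵀ * T₁ := by
    change (S : Matrix (Fin n) (Fin n) ℝ) + -(T₁ᵀ * T₁) = _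
    rw [sub_eq_add_neg]
  refine ⟨S + S₂, h.mem_subdifferential hX (F := T₂) ?_ ?_, S₂,
    h.mem_subdifferential hX (F := T₁) ?_ ?_, (add_sub_cancel_right _ _).symm⟩
  · rw [hS₁, Matrix.mul_sub, Matrix.sub_mul, hSX, Matrix.mul_assoc, Matrix.mul_assoc, hX0]
    simp
  · rw [hS₁, Matrix.mul_sub, Matrix.sub_mul, ← hD, ht, ht', Matrix.mul_assoc, Matrix.mul_assoc,
      hP2, ← Matrix.mul_assoc, hP1, hdiff]
    abel
  · rw [hS₂, Matrix.mul_neg, Matrix.neg_mul, Matrix.mul_assoc, Matrix.mul_assoc, hX0]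
    simp
  · rw [hS₂, Matrix.mul_neg, Matrix.neg_mul, ht, Matrix.mul_assoc, Matrix.mul_assoc, hP2,
      ← Matrix.mul_assoc, hP1]

theorem affineSpan_subdifferential (h : IsFaceProjection A X P Q Z)
    (hX : X ∈ facialSubspace A ∩ psdCone n) :
    affineSpan ℝ (subdifferential (convexIndicator (facialSubspace A ∩ psdCone n)) X) =
      AffineSubspace.mk' 0 (normalSpace (fixedRankFace A X) X) := by
  apply le_antisymm
  · rw [affineSpan_le]
    intro S hS
    simpa using subdifferential_convexIndicator_subset_normalSpace (fixedRankFace_subset A X) hX hS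
  · intro S hS
    have hS' : S ∈ normalSpace (fixedRankFace A X) X := by simpa using hS
    obtain ⟨S₁, h₁, S₂, h₂, rfl⟩ := h.exists_sub_eq_of_mul_mul_eq_zero hX
      (h.mul_mul_eq_zero_of_mem_normalSpace hX.2 hS')
    -- Since `0` is a subgradient, the affine span contains `(S₁ - S₂) + 0`.
    have := AffineSubspace.smul_vsub_vadd_mem _ (1 : ℝ) (subset_affineSpan ℝ _ h₁)
      (subset_affineSpan ℝ _ h₂) (subset_affineSpan ℝ _ (zero_mem_subdifferential_convexIndicator hX))
    simpa using this

end IsFaceProjection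

/-! ### Schur complements relative to an orthogonal projection -/

section Schur

variable {n : ℕ}

/-- The compression of `Y` to the range of the projection `Q`, completed by the identity on the
kernel of `Q`. -/
def pivotBlock (Q Y : Matrix (Fin n) (Fin n) ℝ) : Matrix (Fin n) (Fin n) ℝ :=
  Q * Y * Q + (1 - Q)

/-- The term subtracted from the complementary diagonal block of `Y` in the Schur complement of
`Y` relative to the range of the projection `Q`. -/
noncomputable def schurCorrection (Q Y : Matrix (Fin n) (Fin n) ℝ) : Matrix (Fin n) (Fin n) ℝ :=
  (1 - Q) * (Y * Q) * (pivotBlock Q Y)⁻¹ * (Q * Y * (1 - Q))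

variable {Q Y : Matrix (Fin n) (Fin n) ℝ}

theorem pivotBlock_transpose (hQ : Qᵀ = Q) (hY : Yᵀ = Y) :
    (pivotBlock Q Y)ᵀ = pivotBlock Q Y := by
  simp [pivotBlock, hQ, hY, Matrix.mul_assoc]

theorem schurCorrection_transpose (hQ : Qᵀ = Q) (hY : Yᵀ = Y) :
    (schurCorrection Q Y)ᵀ = schurCorrection Q Y := by
  rw [schurCorrection]
  simp only [Matrix.transpose_mul, Matrix.transpose_nonsing_inv, pivotBlock_transpose hQ hY,
    Matrix.transpose_sub, Matrix.transpose_one, hQ, hY, Matrix.mul_assoc]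

theorem mul_schurCorrection (hQQ : Q * Q = Q) : Q * schurCorrection Q Y = 0 := by
  have h : Q * (1 - Q) = 0 := by rw [Matrix.mul_sub, Matrix.mul_one, hQQ, sub_self]
  simp only [schurCorrection, ← Matrix.mul_assoc, h, Matrix.zero_mul]

theorem schurCorrection_mul (hQQ : Q * Q = Q) : schurCorrection Q Y * Q = 0 := by
  have h : (1 - Q) * Q = 0 := by rw [Matrix.sub_mul, Matrix.one_mul, hQQ, sub_self]
  simp only [schurCorrection, Matrix.mul_assoc, h, Matrix.mul_zero]

theorem pivotBlock_congr {Y' : Matrix (Fin n) (Fin n) ℝ} (h : Q * Y' = Q * Y) :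
    pivotBlock Q Y' = pivotBlock Q Y := by
  rw [pivotBlock, pivotBlock, h]

theorem schurCorrection_congr {Y' : Matrix (Fin n) (Fin n) ℝ} (h : Q * Y' = Q * Y)
    (h' : Y' * Q = Y * Q) : schurCorrection Q Y' = schurCorrection Q Y := by
  rw [schurCorrection, schurCorrection, pivotBlock_congr h, h, h']

theorem pivotBlock_mul (hQQ : Q * Q = Q) : pivotBlock Q Y * Q = Q * Y * Q := by
  simp only [pivotBlock, Matrix.add_mul, Matrix.sub_mul, Matrix.one_mul, Matrix.mul_assoc, hQQ,
    sub_self, add_zero]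

theorem mul_pivotBlock (hQQ : Q * Q = Q) : Q * pivotBlock Q Y = Q * Y * Q := by
  simp only [pivotBlock, Matrix.mul_add, Matrix.mul_sub, Matrix.mul_one, ← Matrix.mul_assoc, hQQ,
    sub_self, add_zero]

theorem inv_pivotBlock_mul (hQQ : Q * Q = Q) (hu : IsUnit (pivotBlock Q Y).det) :
    (pivotBlock Q Y)⁻¹ * (Q * Y * Q) = Q := by
  rw [← pivotBlock_mul hQQ, ← Matrix.mul_assoc, Matrix.nonsing_inv_mul _ hu, Matrix.one_mul]

theorem mul_inv_pivotBlock (hQQ : Q * Q = Q) (hu : IsUnit (pivotBlock Q Y).det) :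
    Q * Y * Q * (pivotBlock Q Y)⁻¹ = Q := by
  rw [← mul_pivotBlock hQQ, Matrix.mul_assoc, Matrix.mul_nonsing_inv _ hu, Matrix.mul_one]

theorem rank_le_rank_mul_of_isUnit_pivotBlock (hQQ : Q * Q = Q)
    (hu : IsUnit (pivotBlock Q Y).det) : Q.rank ≤ (Y * Q).rank := by
  conv_lhs => rw [← inv_pivotBlock_mul hQQ hu, Matrix.mul_assoc Q, ← Matrix.mul_assoc]
  exact Matrix.rank_mul_le_right _ _

theorem exists_eq_mul_of_rank_le_rank (hQQ : Q * Q = Q) (hu : IsUnit (pivotBlock Q Y).det)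
    (hr : Y.rank ≤ Q.rank) : ∃ W, Y = Y * Q * W :=
  Matrix.exists_eq_mul_of_rank_le (hr.trans (rank_le_rank_mul_of_isUnit_pivotBlock hQQ hu))

/-- If `Y` has the rank of `Q`, its Schur complement relative to `Q` vanishes. -/
theorem eq_mul_inv_pivotBlock_mul_of_rank_le (hQQ : Q * Q = Q)
    (hu : IsUnit (pivotBlock Q Y).det) (hr : Y.rank ≤ Q.rank) :
    Y = Y * Q * (pivotBlock Q Y)⁻¹ * (Q * Y) := by
  obtain ⟨W, hW⟩ := exists_eq_mul_of_rank_le_rank hQQ hu hr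
  have h : Y * Q * (pivotBlock Q Y)⁻¹ * (Q * (Y * Q * W)) = Y * Q * W := by
    calc Y * Q * (pivotBlock Q Y)⁻¹ * (Q * (Y * Q * W))
        = Y * Q * ((pivotBlock Q Y)⁻¹ * (Q * Y * Q)) * W := by simp only [Matrix.mul_assoc]
      _ = Y * Q * W := by rw [inv_pivotBlock_mul hQQ hu, Matrix.mul_assoc Y, hQQ]
  rw [← hW] at h
  exact h.symm

theorem rank_le_of_eq_mul_inv_pivotBlock_mul
    (h : Y = Y * Q * (pivotBlock Q Y)⁻¹ * (Q * Y)) : Y.rank ≤ Q.rank := by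
  rw [h, Matrix.mul_assoc, Matrix.mul_assoc]
  exact (Matrix.rank_mul_le_right _ _).trans (Matrix.rank_mul_le_left _ _)

/-- The difference `D` of the two sides of the first equation is annihilated by `Q` on either side,
so `D = (1 - Q) D (1 - Q)`, which is the difference of the two sides of the second. -/
theorem eq_mul_inv_pivotBlock_mul_iff (hQQ : Q * Q = Q) (hu : IsUnit (pivotBlock Q Y).det) :
    Y = Y * Q * (pivotBlock Q Y)⁻¹ * (Q * Y) ↔ (1 - Q) * Y * (1 - Q) = schurCorrection Q Y := by
  set D := Y - Y * Q * (pivotBlock Q Y)⁻¹ * (Q * Y) with hD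
  have hDQ : D * Q = 0 := by
    have : Y * Q * (pivotBlock Q Y)⁻¹ * (Q * Y) * Q = Y * Q := by
      rw [Matrix.mul_assoc _ (Q * Y), Matrix.mul_assoc (Y * Q), inv_pivotBlock_mul hQQ hu,
        Matrix.mul_assoc, hQQ]
    rw [hD, Matrix.sub_mul, this, sub_self]
  have hQD : Q * D = 0 := by
    have : Q * (Y * Q * (pivotBlock Q Y)⁻¹ * (Q * Y)) = Q * Y := by
      simp only [← Matrix.mul_assoc]
      rw [mul_inv_pivotBlock hQQ hu, hQQ]
    rw [hD, Matrix.mul_sub, this, sub_self]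
  have hDD : D = (1 - Q) * Y * (1 - Q) - schurCorrection Q Y := by
    have h1 : D = (1 - Q) * D * (1 - Q) := by
      rw [Matrix.sub_mul 1 Q D, hQD, Matrix.one_mul, sub_zero, Matrix.mul_sub, hDQ, Matrix.mul_one,
        sub_zero]
    refine h1.trans ?_
    rw [hD, schurCorrection, Matrix.mul_sub (1 - Q), Matrix.sub_mul _ _ (1 - Q)]
    simp only [Matrix.mul_assoc]
  rw [← sub_eq_zero, ← hD, hDD, sub_eq_zero]

end Schur

/-! ### Smoothness on the space of symmetric matrices -/

/-- The orthogonal projection of all square matrices onto the symmetric ones. -/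
noncomputable def SymMat.symmetrize (n : ℕ) : Matrix (Fin n) (Fin n) ℝ →ₗ[ℝ] SymMat n where
  toFun M := ⟨(1 / 2 : ℝ) • (M + Mᵀ), by
    change ((1 / 2 : ℝ) • (M + Mᵀ))ᵀ = _
    simp [add_comm]⟩
  map_add' M N := by
    ext1
    change (1 / 2 : ℝ) • (M + N + (M + N)ᵀ) = (1 / 2 : ℝ) • (M + Mᵀ) + (1 / 2 : ℝ) • (N + Nᵀ)
    rw [Matrix.transpose_add]
    module
  map_smul' c M := by
    ext1
    change (1 / 2 : ℝ) • (c • M + (c • M)ᵀ) = c • ((1 / 2 : ℝ) • (M + Mᵀ))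
    rw [Matrix.transpose_smul]
    module

theorem SymMat.coe_symmetrize {n : ℕ} {M : Matrix (Fin n) (Fin n) ℝ} (hM : Mᵀ = M) :
    (SymMat.symmetrize n M : Matrix (Fin n) (Fin n) ℝ) = M := by
  change (1 / 2 : ℝ) • (M + Mᵀ) = M
  rw [hM]
  module

theorem SymMat.contDiff_coe (n : ℕ) :
    ContDiff ℝ 2 (fun Y : SymMat n => (Y : Matrix (Fin n) (Fin n) ℝ)) := by
  let f : SymMat n →L[ℝ] Matrix (Fin n) (Fin n) ℝ := Submodule.subtypeL _
  exact f.contDiff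

theorem SymMat.contDiff_symmetrize (n : ℕ) : ContDiff ℝ 2 (SymMat.symmetrize n) :=
  (LinearMap.toContinuousLinearMap (SymMat.symmetrize n)).contDiff

/-- The Schur correction as a map on symmetric matrices. -/
noncomputable def SymMat.schurCorrection {n : ℕ} (Q : Matrix (Fin n) (Fin n) ℝ) (Y : SymMat n) :
    SymMat n :=
  SymMat.symmetrize n (_root_.schurCorrection Q Y)

theorem SymMat.coe_schurCorrection {n : ℕ} {Q : Matrix (Fin n) (Fin n) ℝ} (hQ : Qᵀ = Q)
    (Y : SymMat n) : (SymMat.schurCorrection Q Y : Matrix (Fin n) (Fin n) ℝ) =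
      _root_.schurCorrection Q Y :=
  SymMat.coe_symmetrize (schurCorrection_transpose hQ Y.transpose_coe)

theorem SymMat.contDiff_pivotBlock {n : ℕ} (Q : Matrix (Fin n) (Fin n) ℝ) :
    ContDiff ℝ 2 (fun Y : SymMat n => pivotBlock Q Y) :=
  ((contDiff_const.mul (SymMat.contDiff_coe n)).mul contDiff_const).add contDiff_const

theorem SymMat.contDiffAt_schurCorrection {n : ℕ} {Q : Matrix (Fin n) (Fin n) ℝ} {Y : SymMat n}
    (hu : IsUnit (pivotBlock Q (Y : Matrix (Fin n) (Fin n) ℝ)).det) :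
    ContDiffAt ℝ 2 (SymMat.schurCorrection Q) Y := by
  have hc : ContDiffAt ℝ 2 (fun Y : SymMat n => (Y : Matrix (Fin n) (Fin n) ℝ)) Y :=
    (SymMat.contDiff_coe n).contDiffAt
  have hinv : ContDiffAt ℝ 2
      (fun Y : SymMat n => (pivotBlock Q (Y : Matrix (Fin n) (Fin n) ℝ))⁻¹) Y :=
    ContDiffAt.comp Y (Matrix.contDiffAt_inv ((Matrix.isUnit_iff_isUnit_det _).2 hu))
      (SymMat.contDiff_pivotBlock Q).contDiffAt
  have h : ContDiffAt ℝ 2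
      (fun Y : SymMat n => _root_.schurCorrection Q (Y : Matrix (Fin n) (Fin n) ℝ)) Y :=
    ((contDiffAt_const.mul (hc.mul contDiffAt_const)).mul hinv).mul
      ((contDiffAt_const.mul hc).mul contDiffAt_const)
  exact (SymMat.contDiff_symmetrize n).contDiffAt.comp Y h

/-! ### The fixed-rank face as a manifold -/

/-- Identifying the range of `L` with a Euclidean space turns `L x = 0` into linearly independent
equations, as the definition of a manifold requires. -/
theorem exists_surjective_euclidean_map_ker_eq {E : Type*} [NormedAddCommGroup E] [NormedSpace ℝ E]
    [FiniteDimensional ℝ E] (L : E →ₗ[ℝ] E) :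
    ∃ (k : ℕ) (F : E →L[ℝ] EuclideanSpace ℝ (Fin k)), Function.Surjective F ∧
      ∀ x, F x = 0 ↔ L x = 0 := by
  let e : LinearMap.range L ≃ₗ[ℝ] EuclideanSpace ℝ (Fin (Module.finrank ℝ (LinearMap.range L))) :=
    LinearEquiv.ofFinrankEq _ _ finrank_euclideanSpace_fin.symm
  refine ⟨_, LinearMap.toContinuousLinearMap (e.toLinearMap ∘ₗ L.rangeRestrict),
    e.surjective.comp L.surjective_rangeRestrict, fun x => ?_⟩
  change e (L.rangeRestrict x) = 0 ↔ _
  rw [map_eq_zero_iff _ e.injective, ← Submodule.coe_eq_zero]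
  rfl

/-- The blocks of a symmetric matrix that the fixed-rank face constrains: the one complementary to
`Q`, and the off-diagonal ones between `Q` and `1 - P`. -/
noncomputable def SymMat.normalBlocks {n : ℕ} (P Q : Matrix (Fin n) (Fin n) ℝ) :
    SymMat n →ₗ[ℝ] SymMat n :=
  SymMat.symmetrize n ∘ₗ (LinearMap.mulLeftRight ℝ (1 - Q, 1 - Q) + LinearMap.mulLeftRight ℝ
    (Q, 1 - P) + LinearMap.mulLeftRight ℝ (1 - P, Q)) ∘ₗ Submodule.subtype _

namespace IsFaceProjection

variable {m n : ℕ} {A : Matrix (Fin m) (Fin n) ℝ} {X : SymMat n}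
  {P Q Z : Matrix (Fin n) (Fin n) ℝ}

theorem coe_normalBlocks (h : IsFaceProjection A X P Q Z) (T : SymMat n) :
    (SymMat.normalBlocks P Q T : Matrix (Fin n) (Fin n) ℝ) =
      (1 - Q) * T * (1 - Q) + Q * T * (1 - P) + (1 - P) * T * Q := by
  refine SymMat.coe_symmetrize ?_
  change ((1 - Q) * T.1 * (1 - Q) + Q * T.1 * (1 - P) + (1 - P) * T.1 * Q)ᵀ =
    (1 - Q) * T.1 * (1 - Q) + Q * T.1 * (1 - P) + (1 - P) * T.1 * Q
  simp only [Matrix.transpose_add, Matrix.transpose_mul, Matrix.transpose_sub,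
    Matrix.transpose_one, h.Q_symm, h.P_symm, T.transpose_coe, ← Matrix.mul_assoc]
  abel

/-- Right multiplication by `Q` isolates the third block, because `(1 - Q) Q = (1 - P) Q = 0`; the
second block is its transpose. -/
theorem normalBlocks_eq_zero_iff (h : IsFaceProjection A X P Q Z) (T : SymMat n) :
    SymMat.normalBlocks P Q T = 0 ↔
      (1 - Q) * (T : Matrix (Fin n) (Fin n) ℝ) * (1 - Q) = 0 ∧
        (1 - P) * (T : Matrix (Fin n) (Fin n) ℝ) * Q = 0 := by
  have h1 : (1 - Q) * Q = 0 := by rw [Matrix.sub_mul, Matrix.one_mul, h.Q_mul_Q, sub_self]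
  have h2 : (1 - P) * Q = 0 := by rw [Matrix.sub_mul, Matrix.one_mul, h.P_mul_Q, sub_self]
  have ht : ((1 - P) * (T : Matrix (Fin n) (Fin n) ℝ) * Q)ᵀ = Q * T.1 * (1 - P) := by
    simp only [Matrix.transpose_mul, Matrix.transpose_sub,
      Matrix.transpose_one, h.Q_symm, h.P_symm, T.transpose_coe, Matrix.mul_assoc]
  rw [← Submodule.coe_eq_zero, h.coe_normalBlocks]
  constructor
  · intro h0
    have h3 : (1 - P) * (T : Matrix (Fin n) (Fin n) ℝ) * Q = 0 := by
      have := congrArg (· * Q) h0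
      simpa only [Matrix.add_mul, Matrix.mul_assoc, h1, h2, h.Q_mul_Q, Matrix.mul_zero, zero_add,
        Matrix.zero_mul] using this
    rw [h3] at ht
    rw [h3, ← ht, Matrix.transpose_zero, add_zero, add_zero] at h0
    exact ⟨h0, h3⟩
  · rintro ⟨h0, h3⟩
    rw [h3] at ht
    rw [h3, ← ht, h0, Matrix.transpose_zero, add_zero, add_zero]

theorem rank_eq (h : IsFaceProjection A X P Q Z) :
    Q.rank = (X : Matrix (Fin n) (Fin n) ℝ).rank := by
  apply le_antisymm
  · rw [← h.X_mul_Z]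
    exact Matrix.rank_mul_le_left _ _
  · conv_lhs => rw [← h.Q_mul_X]
    exact Matrix.rank_mul_le_left _ _

/-- At `X` the pivot block is `X + (1 - Q)`, a sum of semidefinite matrices with inverse `Z + (1 -
Q)`. -/
theorem posDef_pivotBlock (h : IsFaceProjection A X P Q Z) (hX : X ∈ psdCone n) :
    (pivotBlock Q (X : Matrix (Fin n) (Fin n) ℝ)).PosDef := by
  have hp : pivotBlock Q (X : Matrix (Fin n) (Fin n) ℝ) = X + (1 - Q) := by
    rw [pivotBlock, h.Q_mul_X, h.X_mul_Q]
  have hsq : 1 - Q = (1 - Q)ᴴ * (1 - Q) := by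
    rw [Matrix.conjTranspose_eq_transpose_of_trivial, Matrix.transpose_sub, Matrix.transpose_one,
      h.Q_symm, Matrix.mul_sub, Matrix.mul_one, Matrix.sub_mul, h.Q_mul_Q]
    simp
  have hpsd : (pivotBlock Q (X : Matrix (Fin n) (Fin n) ℝ)).PosSemidef := by
    rw [hp, hsq]
    exact Matrix.PosSemidef.add hX (Matrix.posSemidef_conjTranspose_mul_self _)
  refine hpsd.posDef_iff_isUnit.2 ((Matrix.isUnit_iff_isUnit_det _).2
    (Matrix.isUnit_det_of_right_inverse (B := Z + (1 - Q)) ?_))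
  rw [hp]
  simp only [Matrix.add_mul, Matrix.mul_add, Matrix.mul_sub, Matrix.sub_mul, Matrix.one_mul,
    Matrix.mul_one, h.X_mul_Z, h.X_mul_Q, h.Q_mul_Z, h.Q_mul_Q]
  abel

/-- Near `X`, the fixed-rank face is cut out by the constrained blocks of the matrix corrected by
its Schur term. -/
theorem mem_fixedRankFace_iff (h : IsFaceProjection A X P Q Z) {Y : SymMat n}
    (hY : (pivotBlock Q (Y : Matrix (Fin n) (Fin n) ℝ)).PosDef) :
    Y ∈ fixedRankFace A X ↔
      SymMat.normalBlocks P Q (Y - SymMat.schurCorrection Q Y) = 0 := by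
  have hu : IsUnit (pivotBlock Q (Y : Matrix (Fin n) (Fin n) ℝ)).det :=
    (Matrix.isUnit_iff_isUnit_det _).1 hY.isUnit
  have hcoe : ((Y - SymMat.schurCorrection Q Y : SymMat n) : Matrix (Fin n) (Fin n) ℝ) =
      Y - schurCorrection Q Y := by
    rw [← SymMat.coe_schurCorrection h.Q_symm]
    rfl
  have hsq : (1 - Q) * schurCorrection Q (Y : Matrix (Fin n) (Fin n) ℝ) * (1 - Q) =
      schurCorrection Q Y := by
    rw [Matrix.sub_mul, mul_schurCorrection h.Q_mul_Q, Matrix.one_mul, sub_zero, Matrix.mul_sub,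
      schurCorrection_mul h.Q_mul_Q, Matrix.mul_one, sub_zero]
  rw [h.normalBlocks_eq_zero_iff, hcoe, Matrix.mul_sub (1 - Q), Matrix.sub_mul _ _ (1 - Q), hsq,
    sub_eq_zero, ← eq_mul_inv_pivotBlock_mul_iff h.Q_mul_Q hu, Matrix.mul_assoc (1 - P),
    Matrix.sub_mul _ _ Q, schurCorrection_mul h.Q_mul_Q, sub_zero]
  constructor
  · rintro ⟨-, hA, hr⟩
    refine ⟨eq_mul_inv_pivotBlock_mul_of_rank_le h.Q_mul_Q hu (hr.trans h.rank_eq.symm).le, ?_⟩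
    rw [← Matrix.mul_assoc, Matrix.sub_mul, h.P_mul _ hA, Matrix.one_mul, sub_self,
      Matrix.zero_mul]
  · rintro ⟨hs, hP⟩
    refine ⟨?_, ?_, ?_⟩
    · change (Y : Matrix (Fin n) (Fin n) ℝ).PosSemidef
      -- By `hs`, `Y = (YQ) M⁻¹ (YQ)ᴴ` with `M` the positive definite pivot block.
      have ht : Q * (Y : Matrix (Fin n) (Fin n) ℝ) = ((Y : Matrix (Fin n) (Fin n) ℝ) * Q)ᴴ := by
        rw [Matrix.conjTranspose_eq_transpose_of_trivial, Matrix.transpose_mul, h.Q_symm,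
          Y.transpose_coe]
      rw [hs, ht]
      exact hY.inv.posSemidef.mul_mul_conjTranspose_same _
    · have hAYQ : A * ((Y : Matrix (Fin n) (Fin n) ℝ) * Q) = 0 := by
        rw [Matrix.sub_mul, Matrix.one_mul, sub_eq_zero] at hP
        rw [hP, ← Matrix.mul_assoc, h.A_mul_P, Matrix.zero_mul]
      rw [hs, Matrix.mul_assoc, ← Matrix.mul_assoc A, hAYQ, Matrix.zero_mul]
    · rw [← h.rank_eq]
      exact le_antisymm (rank_le_of_eq_mul_inv_pivotBlock_mul hs)
        ((rank_le_rank_mul_of_isUnit_pivotBlock h.Q_mul_Q hu).trans (Matrix.rank_mul_le_left _ _))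

/-- The correction `q` depends only on `QY` and `YQ`, which adding or subtracting `q Y` leaves
unchanged. Hence `Y ↦ Y - q Y` and `T ↦ T + q T` are mutually inverse. -/
theorem isC2ManifoldAround (h : IsFaceProjection A X P Q Z) (hX : X ∈ psdCone n) :
    IsC2ManifoldAround (fixedRankFace A X) X := by
  let L := SymMat.normalBlocks P Q
  let q : SymMat n → SymMat n := SymMat.schurCorrection Q
  obtain ⟨k, F, hFsurj, hF0⟩ := exists_surjective_euclidean_map_ker_eq L
  have hcq (Y : SymMat n) : (q Y : Matrix (Fin n) (Fin n) ℝ) = schurCorrection Q Y :=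
    SymMat.coe_schurCorrection h.Q_symm Y
  have hQq (Y : SymMat n) : Q * (q Y : Matrix (Fin n) (Fin n) ℝ) = 0 := by
    rw [hcq, mul_schurCorrection h.Q_mul_Q]
  have hqQ (Y : SymMat n) : (q Y : Matrix (Fin n) (Fin n) ℝ) * Q = 0 := by
    rw [hcq, schurCorrection_mul h.Q_mul_Q]
  have hadd (T Y : SymMat n) : Q * ((T + q Y : SymMat n) : Matrix (Fin n) (Fin n) ℝ) = Q * T := by
    rw [Submodule.coe_add, Matrix.mul_add, hQq, add_zero]
  have hsub (T Y : SymMat n) : Q * ((T - q Y : SymMat n) : Matrix (Fin n) (Fin n) ℝ) = Q * T := by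
    rw [Submodule.coe_sub, Matrix.mul_sub, hQq, sub_zero]
  have hqadd (T : SymMat n) : q (T + q T) = q T := by
    apply Subtype.ext
    rw [hcq (T + q T), hcq T]
    refine schurCorrection_congr (hadd T T) ?_
    rw [Submodule.coe_add, Matrix.add_mul, hqQ, add_zero]
  have hqsub (T : SymMat n) : q (T - q T) = q T := by
    apply Subtype.ext
    rw [hcq (T - q T), hcq T]
    refine schurCorrection_congr (hsub T T) ?_
    rw [Submodule.coe_sub, Matrix.sub_mul, hqQ, sub_zero]
  let V : Set (SymMat n) :=
    {Y | ∀ x, x ≠ 0 → 0 < x ⬝ᵥ (pivotBlock Q (Y : Matrix (Fin n) (Fin n) ℝ) *ᵥ x)}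
  have hV (Y : SymMat n) (hY : Y ∈ V) : (pivotBlock Q (Y : Matrix (Fin n) (Fin n) ℝ)).PosDef :=
    Matrix.PosDef.of_dotProduct_mulVec_pos (pivotBlock_transpose h.Q_symm Y.transpose_coe)
      fun x hx => hY x hx
  have hVu (Y : SymMat n) (hY : Y ∈ V) :
      IsUnit (pivotBlock Q (Y : Matrix (Fin n) (Fin n) ℝ)).det :=
    (Matrix.isUnit_iff_isUnit_det _).1 (hV Y hY).isUnit
  have hG (Y : SymMat n) (hY : Y ∈ V) : ContDiffAt ℝ 2 (fun Y => F (Y - q Y)) Y :=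
    F.contDiff.contDiffAt.comp Y
      (contDiffAt_id.sub (SymMat.contDiffAt_schurCorrection (hVu Y hY)))
  refine ⟨k, V, fun Y => F (Y - q Y), ?_, ?_, fun Y hY => (hG Y hY).contDiffWithinAt, ?_, ?_⟩
  · exact (Matrix.isOpen_setOf_forall_dotProduct_mulVec_pos n).preimage
      (SymMat.contDiff_pivotBlock Q).continuous
  · exact fun x hx => (h.posDef_pivotBlock hX).dotProduct_mulVec_pos hx
  · intro Y hY
    have hu : IsUnit (pivotBlock Q ((Y - q Y : SymMat n) : Matrix (Fin n) (Fin n) ℝ)).det := by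
      rw [pivotBlock_congr (hsub Y Y)]
      exact hVu Y hY
    have hΨ : DifferentiableAt ℝ (fun T => T + q T) (Y - q Y) :=
      (contDiffAt_id.add (SymMat.contDiffAt_schurCorrection hu)).differentiableAt (by norm_num)
    have hΨY : (fun T => T + q T) (Y - q Y) = Y := by
      simp only [hqsub, sub_add_cancel]
    have hGY : DifferentiableAt ℝ (fun Y => F (Y - q Y)) ((fun T => T + q T) (Y - q Y)) := by
      rw [hΨY]
      exact (hG Y hY).differentiableAt (by norm_num)
    -- By the chain rule the surjection `F` factors through the derivative of the defining map,
    -- which is therefore surjective.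
    have hcomp : (fun Y => F (Y - q Y)) ∘ (fun T => T + q T) = F := by
      ext1 T
      simp only [Function.comp_apply, hqadd, add_sub_cancel_right]
    have hchain := fderiv_comp (Y - q Y) hGY hΨ
    simp only [hqsub, sub_add_cancel] at hchain
    rw [hcomp, ContinuousLinearMap.fderiv] at hchain
    intro z
    obtain ⟨T, rfl⟩ := hFsurj z
    exact ⟨_, (congrArg (fun f => f T) hchain).symm⟩
  · ext Y
    constructor
    · rintro ⟨hM, hY⟩
      exact ⟨hY, (hF0 _).2 ((h.mem_fixedRankFace_iff (hV Y hY)).1 hM)⟩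
    · rintro ⟨hY, h0⟩
      exact ⟨(h.mem_fixedRankFace_iff (hV Y hY)).2 ((hF0 _).1 h0), hY⟩

/-! ### Continuity of the subdifferential -/

/-- For large `k`, the matrix `U k = Y k Z + (1 - Q)` is invertible, maps the range of `X` onto that
of `Y k`, and satisfies `A U = A`. It tends to `XZ + (1 - Q) = 1`, so the transported matrices `U⁻ᵀ
S U⁻¹` tend to `S`. -/
theorem innerSemicontinuousRel (h : IsFaceProjection A X P Q Z)
    (hX : X ∈ facialSubspace A ∩ psdCone n) :
    InnerSemicontinuousRel (subdifferential (convexIndicator (facialSubspace A ∩ psdCone n)))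
      (fixedRankFace A X) X := by
  intro Y S hY hlim hS
  have hSX := h.mul_mul_eq_zero_of_mem_normalSpace hX.2
    (subdifferential_convexIndicator_subset_normalSpace (fixedRankFace_subset A X) hX hS)
  rw [mem_subdifferential_convexIndicator_iff hX] at hS
  have hPSQ : P * (S : Matrix (Fin n) (Fin n) ℝ) * Q = 0 := by
    rw [← h.X_mul_Z, ← Matrix.mul_assoc, hSX, Matrix.zero_mul]
  have hXP : (X : Matrix (Fin n) (Fin n) ℝ) * P = X := h.mul_P X.transpose_coe hX.1
  have hS0 : ((S : Matrix (Fin n) (Fin n) ℝ) * X).trace = 0 := by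
    conv_lhs => rw [← hXP]
    rw [← Matrix.mul_assoc, Matrix.trace_mul_comm, ← Matrix.mul_assoc, hSX, Matrix.trace_zero]
  let U : ℕ → Matrix (Fin n) (Fin n) ℝ := fun k => (Y k : Matrix (Fin n) (Fin n) ℝ) * Z + (1 - Q)
  have hYlim : Tendsto (fun k => (Y k : Matrix (Fin n) (Fin n) ℝ)) atTop
      (𝓝 (X : Matrix (Fin n) (Fin n) ℝ)) :=
    ((SymMat.contDiff_coe n).continuous.tendsto X).comp hlim
  have hU : Tendsto U atTop (𝓝 1) := by
    have := (hYlim.mul_const Z).add_const (1 - Q)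
    rwa [h.X_mul_Z, add_sub_cancel] at this
  have hUinv : Tendsto (fun k => (U k)⁻¹) atTop (𝓝 1) := by
    have := (Matrix.contDiffAt_inv (n := n) isUnit_one).continuousAt.tendsto.comp hU
    rwa [inv_one] at this
  have hUdet : ∀ᶠ k in atTop, IsUnit (U k).det := by
    have hc : Continuous fun M : Matrix (Fin n) (Fin n) ℝ => M.det := continuous_id.matrix_det
    have := (hc.tendsto 1).comp hU
    rw [Matrix.det_one] at this
    filter_upwards [this.eventually_ne one_ne_zero] with k hk using hk.isUnit
  have hpdet : ∀ᶠ k in atTop, IsUnit (pivotBlock Q (Y k : Matrix (Fin n) (Fin n) ℝ)).det := by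
    have hc : Continuous fun T : SymMat n => (pivotBlock Q (T : Matrix (Fin n) (Fin n) ℝ)).det :=
      (SymMat.contDiff_pivotBlock Q).continuous.matrix_det
    have h0 : (pivotBlock Q (X : Matrix (Fin n) (Fin n) ℝ)).det ≠ 0 :=
      ((Matrix.isUnit_iff_isUnit_det _).1 (h.posDef_pivotBlock hX.2).isUnit).ne_zero
    filter_upwards [((hc.tendsto X).comp hlim).eventually_ne h0] with k hk using hk.isUnit
  have hsymm (k : ℕ) : ((U k)⁻¹ᵀ * (S : Matrix (Fin n) (Fin n) ℝ) * (U k)⁻¹)ᵀ =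
      (U k)⁻¹ᵀ * S * (U k)⁻¹ := by
    simp only [Matrix.transpose_mul, Matrix.transpose_transpose, S.transpose_coe, Matrix.mul_assoc]
  refine ⟨fun k => SymMat.symmetrize n ((U k)⁻¹ᵀ * (S : Matrix (Fin n) (Fin n) ℝ) * (U k)⁻¹),
    ?_, ?_⟩
  · filter_upwards [hUdet, hpdet] with k hk hpk
    have hYk := fixedRankFace_subset A X (hY k)
    rw [mem_subdifferential_convexIndicator_iff hYk]
    have hAU : A * U k = A := by
      change A * ((Y k : Matrix (Fin n) (Fin n) ℝ) * Z + (1 - Q)) = A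
      rw [Matrix.mul_add, ← Matrix.mul_assoc, show A * (Y k).1 = 0 from hYk.1, Matrix.mul_sub,
        h.A_mul_Q]
      simp
    have hAV : A * (U k)⁻¹ = A := by
      conv_lhs => rw [← hAU]
      rw [Matrix.mul_assoc, Matrix.mul_nonsing_inv _ hk, Matrix.mul_one]
    have htr (T : SymMat n) : inner ℝ (SymMat.symmetrize n
        ((U k)⁻¹ᵀ * (S : Matrix (Fin n) (Fin n) ℝ) * (U k)⁻¹)) T =
          ((S : Matrix (Fin n) (Fin n) ℝ) * ((U k)⁻¹ * T * (U k)⁻¹ᵀ)).trace := by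
      rw [SymMat.inner_eq_trace, SymMat.coe_symmetrize (hsymm k), Matrix.mul_assoc,
        Matrix.mul_assoc, Matrix.trace_mul_comm]
      simp only [Matrix.mul_assoc]
    -- Since `A U⁻¹ = A`, the congruence `T ↦ U⁻¹ T U⁻ᵀ` maps the face into itself.
    have hle (T : SymMat n) (hT : T ∈ facialSubspace A ∩ psdCone n) :
        ((S : Matrix (Fin n) (Fin n) ℝ) * ((U k)⁻¹ * T * (U k)⁻¹ᵀ)).trace ≤ 0 := by
      let T' : SymMat n := ⟨(U k)⁻¹ * T * (U k)⁻¹ᵀ, by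
        change ((U k)⁻¹ * T.1 * (U k)⁻¹ᵀ)ᵀ = _
        simp only [Matrix.transpose_mul, Matrix.transpose_transpose, T.transpose_coe,
          Matrix.mul_assoc]⟩
      have hT' : T' ∈ facialSubspace A ∩ psdCone n := by
        constructor
        · change A * ((U k)⁻¹ * T.1 * (U k)⁻¹ᵀ) = 0
          rw [← Matrix.mul_assoc, ← Matrix.mul_assoc, hAV, show A * T.1 = 0 from hT.1,
            Matrix.zero_mul]
        · change ((U k)⁻¹ * T.1 * (U k)⁻¹ᵀ).PosSemidef
          rw [← Matrix.conjTranspose_eq_transpose_of_trivial]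
          exact Matrix.PosSemidef.mul_mul_conjTranspose_same hT.2 _
      have := hS T' hT'
      rw [inner_sub_right, SymMat.inner_eq_trace, SymMat.inner_eq_trace, hS0, sub_zero] at this
      exact this
    -- The range of `U⁻¹ Y k` lies in that of `Q` and in `ker A`, so a factor `P S Q = 0` appears in
    -- the trace.
    have hzero : ((S : Matrix (Fin n) (Fin n) ℝ) * ((U k)⁻¹ * Y k * (U k)⁻¹ᵀ)).trace = 0 := by
      obtain ⟨W, hW⟩ := exists_eq_mul_of_rank_le_rank h.Q_mul_Q hpk
        ((hY k).2.2.trans h.rank_eq.symm).le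
      have hUQ : U k * (Q * (X : Matrix (Fin n) (Fin n) ℝ)) =
          (Y k : Matrix (Fin n) (Fin n) ℝ) * Q := by
        change ((Y k : Matrix (Fin n) (Fin n) ℝ) * Z + (1 - Q)) * (Q * X) = _
        rw [h.Q_mul_X, Matrix.add_mul, Matrix.sub_mul, Matrix.one_mul, h.Q_mul_X, sub_self,
          add_zero, Matrix.mul_assoc, h.Z_mul_X]
      have hVY : (U k)⁻¹ * (Y k : Matrix (Fin n) (Fin n) ℝ) = Q * (X * W) := by
        rw [hW, ← hUQ]
        simp only [← Matrix.mul_assoc]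
        rw [Matrix.nonsing_inv_mul _ hk, Matrix.one_mul]
      have hYP : (Y k : Matrix (Fin n) (Fin n) ℝ) * (U k)⁻¹ᵀ * P =
          (Y k : Matrix (Fin n) (Fin n) ℝ) * (U k)⁻¹ᵀ := by
        have h1 := h.P_mul ((U k)⁻¹ * Y k) (by
          rw [← Matrix.mul_assoc, hAV]
          exact hYk.1)
        have h2 := congrArg Matrix.transpose h1
        simpa only [Matrix.transpose_mul, (Y k).transpose_coe, h.P_symm] using h2
      rw [Matrix.mul_assoc, ← hYP, ← Matrix.mul_assoc, ← Matrix.mul_assoc, Matrix.trace_mul_comm,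
        ← Matrix.mul_assoc, ← Matrix.mul_assoc, ← Matrix.mul_assoc, Matrix.mul_assoc _ _ (Y k).1,
        hVY, ← Matrix.mul_assoc, hPSQ]
      simp
    intro T hT
    rw [inner_sub_right, htr, htr, hzero, sub_zero]
    exact hle T hT
  · have hc : Continuous fun M : Matrix (Fin n) (Fin n) ℝ => Mᵀ := continuous_id.matrix_transpose
    have h1 := (hc.tendsto 1).comp hUinv
    have h2 := (h1.mul_const (S : Matrix (Fin n) (Fin n) ℝ)).mul hUinv
    rw [Matrix.transpose_one, Matrix.one_mul, Matrix.mul_one] at h2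
    have h3 := ((SymMat.contDiff_symmetrize n).continuous.tendsto _).comp h2
    rwa [show SymMat.symmetrize n S.1 = S from
      Subtype.ext (SymMat.coe_symmetrize S.transpose_coe)] at h3

end IsFaceProjection

theorem mainTheorem2 {m n : ℕ} (A : Matrix (Fin m) (Fin n) ℝ) (X : SymMat n)
    (hX : X ∈ facialSubspace A ∩ psdCone n) :
    IsPartlySmooth (convexIndicator (facialSubspace A ∩ psdCone n)) (fixedRankFace A X) X := by
  obtain ⟨P, Q, Z, h⟩ := exists_isFaceProjection X.transpose_coe hX.1
  refine ⟨isConvexFun_convexIndicator (convex_facialSubspace_inter_psdCone A), ⟨hX.2, hX.1, rfl⟩,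
    ⟨0, zero_mem_subdifferential_convexIndicator hX⟩, h.isC2ManifoldAround hX.2,
    ⟨fun _ => 0, contDiffAt_const, ?_⟩, ⟨0, h.affineSpan_subdifferential hX⟩,
    outerSemicontinuousRel_subdifferential_convexIndicator (fixedRankFace_subset A X) hX,
    h.innerSemicontinuousRel hX⟩
  filter_upwards [self_mem_nhdsWithin] with Y hY
  rw [convexIndicator_of_mem (fixedRankFace_subset A X hY)]
  rfl
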